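/- Let $\mathbb{F}$ be an algebraically closed field, let $n\ge 0$ be an integer and let $a_1,\dots,a_n\in\mathbb{F}$. In the polynomial ring $\mathbb{F}[\mathbf{x}]=\mathbb{F}[x_1,\dots,x_n]$ put $$\varphi_m=\sum_{i=1}^n a_i x_i^m\quad (m\ge 0),\qquad \Phi_n^k=(\varphi_k,\varphi_{k+1},\dots,\varphi_{k+n-1})\quad (k\ge 1),\qquad \Phi_n=\Phi_n^1 .$$ Then $\varphi_1,\varphi_2,\dots,\varphi_n$ is a regular sequence in $\mathbb{F}[\mathbf{x}]$ if and only if $x_i^{\binom n2+1}\in\Phi_n$ for every $i=1,\dots,n$. Moreover, if this is the case, then for every integer $k\ge 1$ the quotient $\mathbb{F}[\mathbf{x}]/\Phi_n^k$, graded by degree, has Hilbert series $$\sum_{d\ge 0}\dim_{\mathbb{F}}\bigl(\mathbb{F}[\mathbf{x}]/\Phi_n^k\bigr)_d\,t^d=[k]_t\,[k+1]_t\cdots[k+n-1]_t,\qquad\text{where } [m]_t=1+t+\dots+t^{m-1},$$ and in particular it is finite-dimensional with $\dim_{\mathbb{F}}\mathbb{F}[\mathbf{x}]/\Phi_n^k=k(k+1)\cdots(k+n-1)$.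 -/

import Mathlib

noncomputable section

namespace WeightedPowerSum

/-- The weighted power sum `φ_m = ∑ i, a_i * x_i ^ m` in the polynomial ring `F[x_1, …, x_n]`
(the variables are indexed by `Fin n`). -/
def phi {F : Type*} [Field F] {n : ℕ} (a : Fin n → F) (m : ℕ) : MvPolynomial (Fin n) F :=
  ∑ i, MvPolynomial.C (a i) * MvPolynomial.X i ^ m

/-- The ideal `Φ_n^k = (φ_k, φ_{k+1}, …, φ_{k+n-1})` of `F[x_1, …, x_n]`. -/
def PhiIdeal {F : Type*} [Field F] {n : ℕ} (a : Fin n → F) (k : ℕ) :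
    Ideal (MvPolynomial (Fin n) F) :=
  Ideal.span (Set.range fun j : Fin n => phi a (k + j))

theorem phi_isHomogeneous {F : Type*} [Field F] {n : ℕ} (a : Fin n → F) (m : ℕ) :
    (phi a m).IsHomogeneous m := by
  refine MvPolynomial.IsHomogeneous.sum _ _ _ fun i _ => ?_
  exact MvPolynomial.IsHomogeneous.C_mul (MvPolynomial.isHomogeneous_X_pow i m) (a i)

/-- The ideals `Φ_n^k` are homogeneous, so that the quotients by them are graded by degree. -/
theorem PhiIdeal_isHomogeneous {F : Type*} [Field F] {n : ℕ} (a : Fin n → F) (k : ℕ) :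
    letI : GradedAlgebra (MvPolynomial.homogeneousSubmodule (Fin n) F) :=
      MvPolynomial.gradedAlgebra
    (PhiIdeal a k).IsHomogeneous (MvPolynomial.homogeneousSubmodule (Fin n) F) := by
  let : GradedAlgebra (MvPolynomial.homogeneousSubmodule (Fin n) F) :=
    MvPolynomial.gradedAlgebra
  refine Ideal.homogeneous_span _ _ ?_
  rintro _ ⟨j, rfl⟩
  exact ⟨k + j, phi_isHomogeneous a (k + j)⟩

/-- The Hilbert series `∑_d dim ((F[x_1, …, x_n] / I)_d) t ^ d` of the quotient by a homogeneous
ideal `I`. The component of degree `d` of the quotient is the image of the (finite-dimensional)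
space of homogeneous polynomials of degree `d`. -/
def quotientHilbertSeries {F : Type*} [Field F] {n : ℕ} (I : Ideal (MvPolynomial (Fin n) F)) :
    PowerSeries ℤ :=
  PowerSeries.mk fun d =>
    (Module.finrank F
      ((MvPolynomial.homogeneousSubmodule (Fin n) F d).map
        (Ideal.Quotient.mkₐ F I).toLinearMap) : ℤ)

/-- The `t`-analogue `[m]_t = 1 + t + ⋯ + t ^ (m - 1)` of the natural number `m`. -/
def tInt (m : ℕ) : PowerSeries ℤ :=
  ∑ i ∈ Finset.range m, PowerSeries.X ^ i

end WeightedPowerSum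

end

/-! For `n` forms of positive degree in `n` variables, it suffices for regularity that every
variable is nilpotent modulo them (`isWeaklyRegular_of_X_mem_radical`): at the origin they are a
system of parameters of a local ring of depth `n`. Regularity in turn fixes the Hilbert series: each
form of degree `e` contributes a factor `1 - t ^ e`, and dividing by `(1 - t) ^ n` gives the product
of the `[k + j]_t`. For `k = 1` its degree is `n.choose 2`, so every form of the next degree lies in
the ideal. This settles the equivalence. To reach other `k`, note that a vanishing subsum of the
weights would make an indicator vector a common zero for `k = 1`. Hence no nonempty subsum vanishes;
by interpolation any `n` consecutive power sums then have only the trivial zero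
(`eq_zero_of_forall_sum_mul_pow_eq_zero`), and the Nullstellensatz makes the variables nilpotent
modulo `PhiIdeal a k`. -/

open RingTheory.Sequence Pointwise

/-! ### Regular sequences inside an ideal, and exchange of their members. -/

section LocalDepth

variable {R : Type*} [CommRing R]

/-- A linear map `R ⧸ I → M` is an element of `M` killed by `I`, so both sides say that `Hom(R ⧸ I,
M)` vanishes. -/
theorem Ideal.exists_mem_isSMulRegular_iff [IsNoetherianRing R] {M : Type*} [AddCommGroup M] [Module R M]
    [Module.Finite R M] (I : Ideal R) :
    (∃ r ∈ I, IsSMulRegular M r) ↔ ∀ v : M, (∀ r ∈ I, r • v = 0) → v = 0 := by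
  constructor
  · rintro ⟨r, hr, hreg⟩ v hv
    exact hreg.right_eq_zero_of_smul (hv r hr)
  · intro h
    have key := IsSMulRegular.subsingleton_linearMap_iff (R := R) (M := M) (N := R ⧸ I)
    rw [Ideal.annihilator_quotient] at key
    refine key.mp (subsingleton_of_forall_eq 0 fun f => ?_)
    refine Submodule.linearMap_qext _ (LinearMap.ext_ring ?_)
    refine h _ fun r hr => ?_
    rw [← map_smul, LinearMap.comp_apply]
    have : Submodule.mkQ I (r • (1 : R)) = 0 :=
      (Submodule.Quotient.mk_eq_zero I).mpr (by simpa using hr)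
    rw [this, map_zero]

/-- An elementary form of `Hom(R/I, M/xM) ≅ Ext¹(R/I, M) ≅ Hom(R/I, M/fM)`: if `I z ⊆ f M`, write `x
z = f w`; then `w` is killed by `I` modulo `x`, so `w = x w'` and `z = f w'`. -/
theorem IsSMulRegular.quotSMulTop_eq_zero {M : Type*} [AddCommGroup M] [Module R M]
    {I : Ideal R} {x f : R} (hxI : x ∈ I) (hx : IsSMulRegular M x)
    (hf : IsSMulRegular M f)
    (h : ∀ v : QuotSMulTop x M, (∀ r ∈ I, r • v = 0) → v = 0) :
    ∀ v : QuotSMulTop f M, (∀ r ∈ I, r • v = 0) → v = 0 := by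
  have mem (g : R) (u : M) : (Submodule.Quotient.mk u : QuotSMulTop g M) = 0 ↔
      ∃ w, g • w = u := by
    rw [Submodule.Quotient.mk_eq_zero, Submodule.mem_smul_pointwise_iff_exists]
    simp
  intro v hv
  obtain ⟨z, rfl⟩ := Submodule.Quotient.mk_surjective _ v
  have hz : ∀ r ∈ I, ∃ w, f • w = r • z := fun r hr => (mem f _).mp (by
    rw [Submodule.Quotient.mk_smul]; exact hv r hr)
  obtain ⟨w, hw⟩ := hz x hxI
  have hw0 : (Submodule.Quotient.mk w : QuotSMulTop x M) = 0 := by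
    refine h _ fun r hr => ?_
    obtain ⟨u, hu⟩ := hz r hr
    rw [← Submodule.Quotient.mk_smul, mem]
    refine ⟨u, hf ?_⟩
    change f • x • u = f • r • w
    rw [smul_comm f x, hu, smul_comm f r, hw, smul_comm]
  obtain ⟨w', rfl⟩ := (mem x _).mp hw0
  refine (mem f _).mpr ⟨w', hx ?_⟩
  change x • f • w' = x • z
  rw [smul_comm, hw]

/-- `I` contains a weakly `M`-regular sequence of length `n`. -/
def Ideal.HasRegularSeq (I : Ideal R) (M : Type*) [AddCommGroup M] [Module R M] (n : ℕ) : Prop :=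
  ∃ rs : List R, rs.length = n ∧ (∀ r ∈ rs, r ∈ I) ∧ IsWeaklyRegular M rs

theorem Ideal.HasRegularSeq.cons {I : Ideal R} {M : Type*} [AddCommGroup M] [Module R M] {n : ℕ}
    {x : R} (hxI : x ∈ I) (hx : IsSMulRegular M x) (h : I.HasRegularSeq (QuotSMulTop x M) n) :
    I.HasRegularSeq M (n + 1) := by
  obtain ⟨rs, hl, hm, hr⟩ := h
  exact ⟨x :: rs, by simp [hl], by simpa [hxI] using hm, hr.cons hx⟩

theorem Ideal.HasRegularSeq.exists_cons {I : Ideal R} {M : Type*} [AddCommGroup M] [Module R M]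
    {n : ℕ} (h : I.HasRegularSeq M (n + 1)) :
    ∃ x ∈ I, IsSMulRegular M x ∧ I.HasRegularSeq (QuotSMulTop x M) n := by
  obtain ⟨_ | ⟨x, rs⟩, hl, hm, hr⟩ := h
  · simp at hl
  · rw [isWeaklyRegular_cons_iff] at hr
    simp only [List.mem_cons, forall_eq_or_imp] at hm
    exact ⟨x, hm.1, hr.1, rs, by simpa using hl, hm.2, hr.2⟩

theorem Ideal.HasRegularSeq.congr {I : Ideal R} {M N : Type*} [AddCommGroup M] [Module R M]
    [AddCommGroup N] [Module R N] {n : ℕ} (h : I.HasRegularSeq M n) (e : M ≃ₗ[R] N) :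
    I.HasRegularSeq N n := by
  obtain ⟨rs, hl, hm, hr⟩ := h
  exact ⟨rs, hl, hm, (e.isWeaklyRegular_congr rs).mp hr⟩

theorem IsSMulRegular.quotSMulTop_swap {M : Type*} [AddCommGroup M] [Module R M] {x z : R}
    (hx : IsSMulRegular M x) (hz : IsSMulRegular (QuotSMulTop x M) z) :
    IsSMulRegular (QuotSMulTop z M) x := by
  rw [isSMulRegular_quotient_iff_mem_of_smul_mem] at hz ⊢
  intro u hu
  obtain ⟨b, -, hb⟩ := (Submodule.mem_smul_pointwise_iff_exists _ _ _).mp hu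
  obtain ⟨c, -, rfl⟩ := (Submodule.mem_smul_pointwise_iff_exists _ _ _).mp
    (hz b (hb ▸ Submodule.smul_mem_pointwise_smul _ _ _ trivial))
  rw [smul_comm] at hb
  have := hx hb
  exact this ▸ Submodule.smul_mem_pointwise_smul _ _ _ trivial

/-- The quotients `(M / xM) / yM` and `(M / yM) / xM` agree. -/
def QuotSMulTop.swapEquiv (M : Type*) [AddCommGroup M] [Module R M] (x y : R) :
    QuotSMulTop x (QuotSMulTop y M) ≃ₗ[R] QuotSMulTop y (QuotSMulTop x M) :=
  have h (a b : R) : (a • ⊤ : Submodule R (QuotSMulTop b M)) =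
      (a • ⊤ : Submodule R M).map (Submodule.mkQ _) := by
    rw [Submodule.map_pointwise_smul, Submodule.map_top, Submodule.range_mkQ]
  Submodule.quotEquivOfEq _ _ (h x y) ≪≫ₗ Submodule.quotientQuotientEquivQuotientSup _ _ ≪≫ₗ
    Submodule.quotEquivOfEq _ _ (sup_comm _ _) ≪≫ₗ
      (Submodule.quotientQuotientEquivQuotientSup _ _).symm ≪≫ₗ
        Submodule.quotEquivOfEq _ _ (h y x).symm

/-- Any regular element of `I` can be taken as the first member of a longest regular sequence. -/
theorem Ideal.HasRegularSeq.quotSMulTop [IsNoetherianRing R] {I : Ideal R} {n : ℕ} :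
    ∀ {M : Type*} [AddCommGroup M] [Module R M] [Module.Finite R M] {f : R}, f ∈ I →
      IsSMulRegular M f → I.HasRegularSeq M (n + 1) → I.HasRegularSeq (QuotSMulTop f M) n := by
  induction n with
  | zero => intros; exact ⟨[], by simp⟩
  | succ n ih =>
    intro M _ _ _ f hfI hf h
    obtain ⟨x, hxI, hx, h⟩ := h.exists_cons
    obtain ⟨y, hyI, hy, -⟩ := h.exists_cons
    have h1 := I.exists_mem_isSMulRegular_iff.mp ⟨y, hyI, hy⟩
    have h2 := hx.quotSMulTop_eq_zero hxI hf h1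
    -- Exchange `x` for `f` through a `z` regular on `M`, `M/xM` and `M/fM` at once; regularity on
    -- the product module supplies it. Induction then applies to `M/xM` with `z` and to `M/zM` with
    -- `f`.
    have h3 : ∃ z ∈ I, IsSMulRegular (M × QuotSMulTop x M × QuotSMulTop f M) z := by
      rw [Ideal.exists_mem_isSMulRegular_iff]
      rintro ⟨u, v, w⟩ huvw
      simp only [Prod.smul_mk, Prod.mk_eq_zero] at huvw ⊢
      exact ⟨I.exists_mem_isSMulRegular_iff.mp ⟨x, hxI, hx⟩ u fun r hr => (huvw r hr).1,
        h1 v fun r hr => (huvw r hr).2.1, h2 w fun r hr => (huvw r hr).2.2⟩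
    obtain ⟨z, hzI, hz⟩ := h3
    have hzM : IsSMulRegular M z := fun a b hab =>
      (Prod.ext_iff.mp (@hz (a, 0) (b, 0) (by simpa using hab))).1
    have hzx : IsSMulRegular (QuotSMulTop x M) z := fun a b hab =>
      (Prod.ext_iff.mp (Prod.ext_iff.mp
        (@hz (0, a, 0) (0, b, 0) (by simpa using hab))).2).1
    have hzf : IsSMulRegular (QuotSMulTop f M) z := fun a b hab =>
      (Prod.ext_iff.mp (Prod.ext_iff.mp
        (@hz (0, 0, a) (0, 0, b) (by simpa using hab))).2).2
    have h4 := ih hzI hzx h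
    have h5 : I.HasRegularSeq (QuotSMulTop z M) (n + 1) :=
      .cons hxI (hx.quotSMulTop_swap hzx) (h4.congr (QuotSMulTop.swapEquiv M z x))
    exact .cons hzI hzf ((ih hfI (hf.quotSMulTop_swap hzf) h5).congr
      (QuotSMulTop.swapEquiv M f z))

/-! ### Depth and dimension over a Noetherian local ring. -/

section Local

variable [IsNoetherianRing R] [IsLocalRing R]

open IsLocalRing

theorem exists_lt_mem_associatedPrimes_quotSMulTop {M : Type*} [AddCommGroup M] [Module R M]
    [Module.Finite R M] {x : R} (hxm : x ∈ maximalIdeal R) (hx : IsSMulRegular M x) {P : Ideal R}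
    (hP : P ∈ associatedPrimes R M) :
    ∃ Q ∈ associatedPrimes R (QuotSMulTop x M), P < Q := by
  obtain ⟨hPp, w, hw⟩ := isAssociatedPrime_iff.mp hP
  have hPw (p : R) : p ∈ P ↔ p • w = 0 := by
    rw [hw, Submodule.mem_colon_singleton, Submodule.mem_bot]
  have hw0 : w ≠ 0 := fun h => hPp.ne_top ((Ideal.eq_top_iff_one _).mpr ((hPw 1).mpr (by simp [h])))
  have hxP : x ∉ P := fun h => hw0 (hx.right_eq_zero_of_smul ((hPw x).mp h))
  let U : Submodule R M := Submodule.torsionBySet R M P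
  have hU (z : M) : z ∈ U ↔ ∀ p ∈ P, p • z = 0 := by simp [U, Submodule.mem_torsionBySet_iff]
  -- As `x` is regular, `x y ∈ U` forces `y ∈ U`; so `U ≤ x M` would give `U = x U`, hence `U = 0`
  -- by Nakayama. An element of `U` outside `x M` then has a class killed by both `P` and `x`.
  have hUx : ¬ U ≤ x • ⊤ := by
    intro hle
    have : U = ⊥ := by
      refine Submodule.eq_bot_of_le_smul_of_le_jacobson_bot (maximalIdeal R) U
        (IsNoetherian.noetherian U) (fun z hz => ?_) (maximalIdeal_le_jacobson _)
      obtain ⟨y, -, rfl⟩ := (Submodule.mem_smul_pointwise_iff_exists _ _ _).mp (hle hz)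
      refine Submodule.smul_mem_smul hxm ((hU y).mpr fun p hp => hx ?_)
      change x • p • y = x • 0
      rw [smul_comm, (hU _).mp hz p hp, smul_zero]
    exact hw0 ((Submodule.mem_bot R).mp (this ▸ (hU w).mpr fun p hp => (hPw p).mp hp))
  obtain ⟨z, hzU, hz⟩ := SetLike.not_le_iff_exists.mp hUx
  obtain ⟨Q, hQ, hle⟩ := exists_le_isAssociatedPrime_of_isNoetherianRing R
    (Submodule.Quotient.mk z : QuotSMulTop x M)
    (fun h => hz ((Submodule.Quotient.mk_eq_zero _).mp h))
  refine ⟨Q, hQ, lt_of_le_of_ne (fun p hp => hle ?_) fun h => hxP (h ▸ hle ?_)⟩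
  · rw [Submodule.mem_colon_singleton, Submodule.mem_bot, ← Submodule.Quotient.mk_smul,
      (hU z).mp hzU p hp, Submodule.Quotient.mk_zero]
  · rw [Submodule.mem_colon_singleton, Submodule.mem_bot, ← Submodule.Quotient.mk_smul,
      Submodule.Quotient.mk_eq_zero]
    exact Submodule.smul_mem_pointwise_smul _ _ _ trivial

omit [IsNoetherianRing R] [IsLocalRing R] in
theorem ringKrullDim_quotient_add_one_le_of_lt {P Q : Ideal R} [P.IsPrime] (h : P < Q) :
    ringKrullDim (R ⧸ Q) + 1 ≤ ringKrullDim (R ⧸ P) := by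
  obtain ⟨x, hxQ, hxP⟩ := SetLike.exists_of_lt h
  have hx : Ideal.Quotient.mk P x ∈ nonZeroDivisors (R ⧸ P) :=
    mem_nonZeroDivisors_of_ne_zero fun h0 => hxP (Ideal.Quotient.eq_zero_iff_mem.mp h0)
  refine le_trans ?_ (ringKrullDim_quotient_succ_le_of_nonZeroDivisor hx)
  gcongr
  have hle : Ideal.span {Ideal.Quotient.mk P x} ≤
      RingHom.ker (Ideal.Quotient.factor h.le) := by
    rw [Ideal.span_singleton_le_iff_mem, RingHom.mem_ker, Ideal.Quotient.factor_mk]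
    exact Ideal.Quotient.eq_zero_iff_mem.mpr hxQ
  exact ringKrullDim_le_of_surjective (Ideal.Quotient.lift _ _ fun a ha => hle ha)
    (Ideal.Quotient.lift_surjective_of_surjective _ _ (Ideal.Quotient.factor_surjective h.le))

/-- Each member of the sequence pushes an associated prime strictly upwards, costing one dimension.
-/
theorem Ideal.HasRegularSeq.le_ringKrullDim_quotient {n : ℕ} :
    ∀ {M : Type*} [AddCommGroup M] [Module R M] [Module.Finite R M],
      (maximalIdeal R).HasRegularSeq M n → ∀ {P : Ideal R}, P ∈ associatedPrimes R M →
        (n : WithBot ℕ∞) ≤ ringKrullDim (R ⧸ P) := by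
  induction n with
  | zero =>
    intro M _ _ _ _ P hP
    have := hP.isPrime
    exact_mod_cast ringKrullDim_nonneg_of_nontrivial
  | succ n ih =>
    intro M _ _ _ h P hP
    have := hP.isPrime
    obtain ⟨x, hxm, hx, h⟩ := h.exists_cons
    obtain ⟨Q, hQ, hlt⟩ := exists_lt_mem_associatedPrimes_quotSMulTop hxm hx hP
    refine le_trans ?_ (ringKrullDim_quotient_add_one_le_of_lt hlt)
    push_cast
    gcongr
    exact ih h hQ

theorem Module.supportDim_le_length_of_maximalIdeal_le_radical (fs : List R) :
    ∀ {M : Type*} [AddCommGroup M] [Module R M] [Module.Finite R M],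
      (∀ f ∈ fs, f ∈ maximalIdeal R) →
      maximalIdeal R ≤ (Module.annihilator R M ⊔ Ideal.ofList fs).radical →
      Module.supportDim R M ≤ fs.length := by
  induction fs with
  | nil =>
    intro M _ _ _ _ h
    have : Subsingleton (Module.support R M) := by
      have key : ∀ p ∈ Module.support R M, p.asIdeal = maximalIdeal R := fun p hp =>
        ((IsLocalRing.maximalIdeal.isMaximal R).eq_of_le p.2.ne_top
          (h.trans (p.2.radical_le_iff.mpr (by
            simpa using Module.mem_support_iff_of_finite.mp hp)))).symm
      exact ⟨fun p q => Subtype.ext (PrimeSpectrum.ext ((key p p.2).trans (key q q.2).symm))⟩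
    exact_mod_cast Order.krullDim_nonpos_of_subsingleton
  | cons f fs ih =>
    intro M _ _ _ hm h
    simp only [List.mem_cons, forall_eq_or_imp] at hm
    refine (Module.supportDim_le_supportDim_quotSMulTop_succ hm.1).trans ?_
    push_cast [List.length_cons]
    gcongr
    refine ih hm.2 (h.trans (Ideal.radical_mono ?_))
    rw [Ideal.ofList_cons, ← sup_assoc]
    refine sup_le_sup_right (sup_le ?_ ?_) _
    · exact LinearMap.annihilator_le_of_surjective (Submodule.mkQ _) (Submodule.mkQ_surjective _)
    · exact (Ideal.span_singleton_le_iff_mem _).mpr (QuotSMulTop.mem_annihilator _ f)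

/-- A system of parameters of a module of maximal depth is a weakly regular sequence. -/
theorem Ideal.HasRegularSeq.isWeaklyRegular (fs : List R) :
    ∀ {M : Type*} [AddCommGroup M] [Module R M] [Module.Finite R M],
      (maximalIdeal R).HasRegularSeq M fs.length → (∀ f ∈ fs, f ∈ maximalIdeal R) →
      maximalIdeal R ≤ (Module.annihilator R M ⊔ Ideal.ofList fs).radical →
      IsWeaklyRegular M fs := by
  induction fs with
  | nil => intros; exact .nil _ _
  | cons f fs ih =>
    intro M _ _ _ hd hm h
    simp only [List.mem_cons, forall_eq_or_imp] at hm
    rw [Ideal.ofList_cons, ← sup_assoc] at h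
    have hf : IsSMulRegular M f := by
      -- A zero divisor `f` lies in an associated prime `P`. The remaining `fs` already cut out the
      -- closed point in `R ⧸ P`, so its dimension is at most `fs.length`, against the depth bound
      -- `fs.length + 1`.
      by_contra hf
      have : f ∈ ⋃ p ∈ associatedPrimes R M, (p : Set R) := by
        rw [biUnion_associatedPrimes_eq_compl_regular]
        exact hf
      simp only [Set.mem_iUnion, SetLike.mem_coe] at this
      obtain ⟨P, hP, hfP⟩ := this
      have h1 := hd.le_ringKrullDim_quotient hP
      have h2 : Module.supportDim R (R ⧸ P) ≤ fs.length := by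
        refine Module.supportDim_le_length_of_maximalIdeal_le_radical fs hm.2
          (h.trans (Ideal.radical_mono (sup_le_sup_right (sup_le ?_ ?_) _)))
        · rw [Ideal.annihilator_quotient]
          exact Submodule.annihilator_top (R := R) (M := M) ▸ hP.annihilator_le
        · rw [Ideal.annihilator_quotient]
          exact (Ideal.span_singleton_le_iff_mem _).mpr hfP
      rw [Module.supportDim_quotient_eq_ringKrullDim] at h2
      have := h1.trans h2
      rw [List.length_cons] at this
      have : fs.length + 1 ≤ fs.length := by exact_mod_cast this
      omega
    refine .cons hf (ih (hd.quotSMulTop hm.1 hf) hm.2 (h.trans (Ideal.radical_mono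
      (sup_le_sup_right (sup_le ?_ ?_) _))))
    · exact LinearMap.annihilator_le_of_surjective (Submodule.mkQ _) (Submodule.mkQ_surjective _)
    · exact (Ideal.span_singleton_le_iff_mem _).mpr (QuotSMulTop.mem_annihilator _ f)

end Local

end LocalDepth

theorem RingTheory.Sequence.isWeaklyRegular_self_iff {R : Type*} [CommRing R] (rs : List R) :
    IsWeaklyRegular R rs ↔ ∀ (i : ℕ) (h : i < rs.length) (x : R),
      rs[i] * x ∈ Ideal.ofList (rs.take i) → x ∈ Ideal.ofList (rs.take i) := by
  rw [isWeaklyRegular_iff]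
  refine forall₂_congr fun i h => ?_
  rw [isSMulRegular_quotient_iff_mem_of_smul_mem, smul_eq_mul, Ideal.mul_top]
  rfl

/-! ### Homogeneous ideals and regular sequences of forms. -/

namespace MvPolynomial

section CommRing

variable {σ R : Type*} [CommRing R]

theorem homogeneousComponent_add_mul {f : MvPolynomial σ R} {e : ℕ} (hf : f.IsHomogeneous e)
    (d : ℕ) (p : MvPolynomial σ R) :
    homogeneousComponent (e + d) (f * p) = f * homogeneousComponent d p := by
  have h (i : ℕ) : homogeneousComponent (e + d) (f * homogeneousComponent i p) =
      if d = i then f * homogeneousComponent i p else 0 := by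
    rw [homogeneousComponent_of_mem (hf.mul (homogeneousComponent_isHomogeneous i p))]
    simp
  conv_lhs => rw [← sum_homogeneousComponent p, Finset.mul_sum, map_sum]
  simp_rw [h, Finset.sum_ite_eq]
  split_ifs with hd
  · rfl
  · rw [homogeneousComponent_eq_zero, mul_zero]
    simpa using hd

theorem homogeneousComponent_mul_of_lt {f : MvPolynomial σ R} {e : ℕ} (hf : f.IsHomogeneous e)
    {d : ℕ} (hd : d < e) (p : MvPolynomial σ R) : homogeneousComponent d (f * p) = 0 := by
  rw [← sum_homogeneousComponent p, Finset.mul_sum, map_sum]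
  refine Finset.sum_eq_zero fun i _ => ?_
  rw [homogeneousComponent_of_mem (hf.mul (homogeneousComponent_isHomogeneous i p)),
    if_neg (by omega)]

theorem homogeneousComponent_mem_span {s : Set (MvPolynomial σ R)}
    (hs : ∀ f ∈ s, ∃ e, f.IsHomogeneous e) {p : MvPolynomial σ R} (hp : p ∈ Ideal.span s) (d : ℕ) :
    homogeneousComponent d p ∈ Ideal.span s := by
  let : GradedAlgebra (homogeneousSubmodule σ R) := gradedAlgebra
  exact homogeneousComponent_mem_of_mem (Ideal.homogeneous_span _ _ hs) hp d

theorem mem_of_homogeneousComponent_mem {I : Ideal (MvPolynomial σ R)} {p : MvPolynomial σ R}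
    (h : ∀ d, homogeneousComponent d p ∈ I) : p ∈ I := by
  rw [← sum_homogeneousComponent p]
  exact I.sum_mem fun d _ => h d

theorem mem_span_range_X_of_constantCoeff_eq_zero {p : MvPolynomial σ R}
    (hp : constantCoeff p = 0) : p ∈ Ideal.span (Set.range (X : σ → MvPolynomial σ R)) := by
  rw [← Set.image_univ, mem_ideal_span_X_image]
  intro m hm
  by_contra! h
  have : m = 0 := Finsupp.ext fun i => h i trivial
  subst this
  exact mem_support_iff.mp hm hp

theorem isWeaklyRegular_ofFn_X (R : Type*) [CommRing R] (n : ℕ) :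
    IsWeaklyRegular (MvPolynomial (Fin n) R) (List.ofFn (X : Fin n → MvPolynomial (Fin n) R)) := by
  rw [isWeaklyRegular_self_iff]
  intro i hi p hp
  have hi' : i < n := by simpa using hi
  have hspan : Ideal.ofList ((List.ofFn (X : Fin n → MvPolynomial (Fin n) R)).take i) =
      Ideal.span (X '' {j : Fin n | (j : ℕ) < i}) := by
    rw [Ideal.ofList]
    congr 1
    ext f
    simp only [List.mem_take_iff_getElem, List.getElem_ofFn, List.length_ofFn, Set.mem_ofPred_eq,
      Set.mem_image]
    constructor
    · rintro ⟨j, hj, rfl⟩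
      exact ⟨⟨j, by omega⟩, by simp; omega, rfl⟩
    · rintro ⟨j, hj, rfl⟩
      exact ⟨j, by omega, rfl⟩
  rw [hspan, mem_ideal_span_X_image] at hp ⊢
  intro m hm
  rw [List.getElem_ofFn] at hp
  obtain ⟨j, hj, hne⟩ := hp (Finsupp.single ⟨i, hi'⟩ 1 + m) (by
    rw [mem_support_iff, coeff_X_mul]
    exact mem_support_iff.mp hm)
  refine ⟨j, hj, ?_⟩
  rwa [Finsupp.add_apply, Finsupp.single_eq_of_ne, zero_add] at hne
  rintro rfl
  simp at hj

end CommRing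

variable {F : Type*} [Field F]

/-- If `n` homogeneous polynomials of positive degree in `n` variables have only the trivial common
zero, then they form a weakly regular sequence. -/
theorem isWeaklyRegular_of_X_mem_radical {n : ℕ} (fs : List (MvPolynomial (Fin n) F))
    (hlen : fs.length = n) (hom : ∀ f ∈ fs, ∃ e, 0 < e ∧ f.IsHomogeneous e)
    (h : ∀ i, X i ∈ (Ideal.ofList fs).radical) :
    IsWeaklyRegular (MvPolynomial (Fin n) F) fs := by
  let m : Ideal (MvPolynomial (Fin n) F) := RingHom.ker (constantCoeff (R := F) (σ := Fin n))
  have : m.IsPrime := RingHom.ker_isPrime _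
  let S := Localization.AtPrime m
  have : IsNoetherianRing S := IsLocalization.isNoetherianRing m.primeCompl S inferInstance
  have hX : ∀ i, X i ∈ m := fun i => by simp [m, RingHom.mem_ker]
  have hfm : ∀ f ∈ fs, f ∈ m := fun f hf => by
    obtain ⟨e, he, hfe⟩ := hom f hf
    exact hfe.coeff_eq_zero (d := 0) (by simpa using he.ne)
  have hm : m ≤ (Ideal.ofList fs).radical := fun p hp =>
    (Ideal.span_le.mpr (Set.range_subset_iff.mpr h))
      (mem_span_range_X_of_constantCoeff_eq_zero hp)
  -- In the localization at the origin the variables supply a regular sequence of length `n`.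
  have hS : IsWeaklyRegular S (fs.map (algebraMap _ S)) := by
    refine Ideal.HasRegularSeq.isWeaklyRegular _ ⟨_, ?_, ?_,
      (isWeaklyRegular_ofFn_X F n).of_isLocalization S m.primeCompl⟩ ?_ ?_
    · simp [hlen]
    · simp only [List.mem_map, forall_exists_index, and_imp]
      rintro _ f hf rfl
      obtain ⟨i, rfl⟩ := (List.mem_ofFn' _ _).mp hf
      exact (IsLocalization.AtPrime.to_map_mem_maximal_iff S m _).mpr (hX i)
    · simp only [List.mem_map, forall_exists_index, and_imp]
      rintro _ f hf rfl
      exact (IsLocalization.AtPrime.to_map_mem_maximal_iff S m _).mpr (hfm f hf)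
    · rw [← Localization.AtPrime.map_eq_maximalIdeal, ← Ideal.map_ofList]
      exact (Ideal.map_mono hm).trans ((Ideal.map_radical_le _).trans
        (Ideal.radical_mono le_sup_right))
  rw [isWeaklyRegular_self_iff] at hS ⊢
  intro i hi p hp
  have hhom : ∀ f ∈ {f | f ∈ fs.take i}, ∃ e, f.IsHomogeneous e := fun f hf =>
    let ⟨e, _, he⟩ := hom f (List.mem_of_mem_take hf)
    ⟨e, he⟩
  obtain ⟨e, -, he⟩ := hom fs[i] (List.getElem_mem hi)
  refine mem_of_homogeneousComponent_mem fun d => ?_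
  have hd : fs[i] * homogeneousComponent d p ∈ Ideal.ofList (fs.take i) := by
    rw [← homogeneousComponent_add_mul he]
    exact homogeneousComponent_mem_span hhom hp _
  have hloc := hS i (by simpa using hi) (algebraMap _ S (homogeneousComponent d p)) (by
    rw [List.getElem_map, ← map_mul, ← List.map_take, ← Ideal.map_ofList]
    exact Ideal.mem_map_of_mem _ hd)
  rw [← List.map_take, ← Ideal.map_ofList,
    IsLocalization.algebraMap_mem_map_algebraMap_iff m.primeCompl] at hloc
  obtain ⟨u, hu, hup⟩ := hloc
  -- Descent from the localization: the denominator `u` has nonzero constant term, and the degree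
  -- `d` part of `u` times a form of degree `d` is that constant times the form.
  have hu0 : coeff 0 u ≠ 0 := hu
  have := homogeneousComponent_mem_span hhom hup (d + 0)
  rw [mul_comm, homogeneousComponent_add_mul (homogeneousComponent_isHomogeneous d p),
    homogeneousComponent_zero] at this
  have := Ideal.mul_mem_right (C (coeff 0 u)⁻¹) _ this
  rwa [mul_assoc, ← C_mul, mul_inv_cancel₀ hu0, C_1, mul_one] at this

end MvPolynomial

/-! ### Hilbert series of graded quotients. -/

namespace WeightedPowerSum

open MvPolynomial

variable {F : Type*} [Field F] {n : ℕ}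

/-- The component of degree `d` of `F[x_1, …, x_n] / I`. -/
noncomputable abbrev quotientComponent (I : Ideal (MvPolynomial (Fin n) F)) (d : ℕ) :
    Submodule F (MvPolynomial (Fin n) F ⧸ I) :=
  (homogeneousSubmodule (Fin n) F d).map (Ideal.Quotient.mkₐ F I).toLinearMap

instance (I : Ideal (MvPolynomial (Fin n) F)) (d : ℕ) : Module.Finite F (quotientComponent I d) :=
  Module.Finite.iff_fg.mpr ((homogeneousSubmodule_fg (Fin n) F d).map _)

theorem mem_quotientComponent {I : Ideal (MvPolynomial (Fin n) F)} {d : ℕ}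
    {v : MvPolynomial (Fin n) F ⧸ I} :
    v ∈ quotientComponent I d ↔ ∃ p, p.IsHomogeneous d ∧ Ideal.Quotient.mk I p = v :=
  Iff.rfl

theorem coeff_quotientHilbertSeries (I : Ideal (MvPolynomial (Fin n) F)) (d : ℕ) :
    PowerSeries.coeff d (quotientHilbertSeries I) = Module.finrank F (quotientComponent I d) :=
  PowerSeries.coeff_mk _ _

/-- Multiplication by `f` is injective on the quotient by `I` and raises degree by `e`; in degree
`d` its image is the kernel of the projection to the quotient by `I ⊔ span {f}`. -/
theorem quotientHilbertSeries_sup_span {I : Ideal (MvPolynomial (Fin n) F)}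
    (hI : ∀ p ∈ I, ∀ d, homogeneousComponent d p ∈ I) {f : MvPolynomial (Fin n) F} {e : ℕ}
    (hf : f.IsHomogeneous e) (hreg : ∀ p, f * p ∈ I → p ∈ I) :
    quotientHilbertSeries (I ⊔ Ideal.span {f}) =
      (1 - PowerSeries.X ^ e) * quotientHilbertSeries I := by
  ext d
  rw [sub_mul, one_mul, map_sub, PowerSeries.coeff_X_pow_mul', eq_sub_iff_add_eq]
  simp only [coeff_quotientHilbertSeries]
  set J := I ⊔ Ideal.span {f} with hJ
  let π : (MvPolynomial (Fin n) F ⧸ I) →ₗ[F] (MvPolynomial (Fin n) F ⧸ J) :=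
    (Ideal.Quotient.factorₐ F (le_sup_left : I ≤ J)).toLinearMap
  have hπ (p) : π (Ideal.Quotient.mk I p) = Ideal.Quotient.mk J p := rfl
  have hrange : LinearMap.range (π.domRestrict (quotientComponent I d)) =
      quotientComponent J d := by
    rw [LinearMap.range_domRestrict, quotientComponent, ← Submodule.map_comp]
    rfl
  have hrank := LinearMap.finrank_range_add_finrank_ker (π.domRestrict (quotientComponent I d))
  have hker : Module.finrank F (LinearMap.ker (π.domRestrict (quotientComponent I d))) =
      Module.finrank F (quotientComponent I d ⊓ LinearMap.ker π : Submodule F _) := by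
    rw [← Submodule.finrank_map_subtype_eq, LinearMap.ker_domRestrict,
      Submodule.map_comap_subtype]
  have hmem (v) : v ∈ quotientComponent I d ⊓ LinearMap.ker π ↔
      ∃ p i r, p.IsHomogeneous d ∧ i ∈ I ∧ p = homogeneousComponent d i +
        homogeneousComponent d (f * r) ∧ Ideal.Quotient.mk I p = v := by
    rw [Submodule.mem_inf, mem_quotientComponent]
    constructor
    · rintro ⟨⟨p, hp, rfl⟩, hv⟩
      rw [LinearMap.mem_ker, hπ, Ideal.Quotient.eq_zero_iff_mem, Submodule.mem_sup] at hv
      obtain ⟨i, hi, g, hg, rfl⟩ := hv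
      obtain ⟨r, rfl⟩ := Ideal.mem_span_singleton'.mp hg
      refine ⟨_, i, r, hp, hi, ?_, rfl⟩
      rw [mul_comm f, ← map_add, homogeneousComponent_eq_self hp]
    · rintro ⟨p, i, r, hp, hi, h, rfl⟩
      refine ⟨⟨p, hp, rfl⟩, ?_⟩
      rw [LinearMap.mem_ker, hπ, Ideal.Quotient.eq_zero_iff_mem, h]
      refine J.add_mem (le_sup_left (a := I) (hI i hi d)) (le_sup_right (a := I) ?_)
      exact homogeneousComponent_mem_span (by rintro _ rfl; exact ⟨e, hf⟩)
        (Ideal.mul_mem_right _ _ (Ideal.mem_span_singleton_self f)) d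
  rw [hrange, hker] at hrank
  rw [← hrank, Nat.cast_add]
  congr 1
  split_ifs with hd
  · obtain ⟨c, rfl⟩ := Nat.exists_eq_add_of_le hd
    let μ : (MvPolynomial (Fin n) F ⧸ I) →ₗ[F] (MvPolynomial (Fin n) F ⧸ I) :=
      LinearMap.mulLeft F (Ideal.Quotient.mk I f)
    have hμ : Function.Injective μ := by
      rw [← LinearMap.ker_eq_bot, LinearMap.ker_eq_bot']
      intro v hv
      obtain ⟨p, rfl⟩ := Ideal.Quotient.mk_surjective v
      rw [LinearMap.mulLeft_apply, ← map_mul, Ideal.Quotient.eq_zero_iff_mem] at hv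
      exact Ideal.Quotient.eq_zero_iff_mem.mpr (hreg p hv)
    have : quotientComponent I (e + c) ⊓ LinearMap.ker π = (quotientComponent I c).map μ := by
      ext v
      rw [hmem, Submodule.mem_map]
      constructor
      · rintro ⟨p, i, r, hp, hi, rfl, rfl⟩
        refine ⟨_, mem_quotientComponent.mpr ⟨_, homogeneousComponent_isHomogeneous c r, rfl⟩, ?_⟩
        rw [LinearMap.mulLeft_apply, ← map_mul, map_add,
          Ideal.Quotient.eq_zero_iff_mem.mpr (hI i hi _), zero_add, homogeneousComponent_add_mul hf]
      · rintro ⟨_, ⟨p, hp, rfl⟩, rfl⟩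
        refine ⟨f * p, 0, p, hf.mul hp, I.zero_mem, ?_, map_mul _ _ _⟩
        rw [map_zero, zero_add, homogeneousComponent_eq_self (hf.mul hp)]
    rw [this, Nat.add_sub_cancel_left,
      ← (Submodule.equivMapOfInjective μ hμ (quotientComponent I c)).finrank_eq]
  · have : quotientComponent I d ⊓ LinearMap.ker π = ⊥ := by
      rw [eq_bot_iff]
      intro v hv
      obtain ⟨p, i, r, hp, hi, rfl, rfl⟩ := (hmem v).mp hv
      rw [homogeneousComponent_mul_of_lt hf (by omega), add_zero, Submodule.mem_bot]
      exact Ideal.Quotient.eq_zero_iff_mem.mpr (hI i hi _)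
    rw [this, finrank_bot, Nat.cast_zero]

theorem quotientHilbertSeries_ofList {fs : List (MvPolynomial (Fin n) F)}
    (hreg : IsWeaklyRegular (MvPolynomial (Fin n) F) fs) (e : ℕ → ℕ)
    (he : ∀ (i : ℕ) (h : i < fs.length), fs[i].IsHomogeneous (e i)) :
    quotientHilbertSeries (Ideal.ofList fs) =
      (∏ i ∈ Finset.range fs.length, (1 - PowerSeries.X ^ e i)) *
        quotientHilbertSeries (⊥ : Ideal (MvPolynomial (Fin n) F)) := by
  rw [isWeaklyRegular_self_iff] at hreg
  have key (i : ℕ) (hi : i ≤ fs.length) : quotientHilbertSeries (Ideal.ofList (fs.take i)) =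
      (∏ j ∈ Finset.range i, (1 - PowerSeries.X ^ e j)) *
        quotientHilbertSeries (⊥ : Ideal (MvPolynomial (Fin n) F)) := by
    induction i with
    | zero => simp
    | succ i ih =>
      rw [List.take_succ_eq_append_getElem hi, Ideal.ofList_append, Ideal.ofList_singleton,
        quotientHilbertSeries_sup_span _ (he i hi) (hreg i hi), ih (by omega),
        Finset.prod_range_succ]
      · ring
      · intro p hp d
        refine homogeneousComponent_mem_span (fun f hf => ?_) hp d
        obtain ⟨j, hj, rfl⟩ := List.getElem_of_mem (List.mem_of_mem_take hf)
        exact ⟨_, he j hj⟩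
  simpa using key fs.length le_rfl

theorem quotientHilbertSeries_span_X :
    quotientHilbertSeries (Ideal.span (Set.range (X : Fin n → MvPolynomial (Fin n) F))) = 1 := by
  ext d
  rw [coeff_quotientHilbertSeries, PowerSeries.coeff_one]
  have hle : Ideal.span (Set.range (X : Fin n → MvPolynomial (Fin n) F)) ≤
      RingHom.ker (constantCoeff (R := F) (σ := Fin n)) := by
    rw [Ideal.span_le]
    rintro _ ⟨i, rfl⟩
    simp [RingHom.mem_ker]
  split_ifs with hd
  · subst hd
    rw [quotientComponent, homogeneousSubmodule_zero, Submodule.map_one,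
      Submodule.one_eq_span, finrank_span_singleton, Nat.cast_one]
    intro h
    have := hle (Ideal.Quotient.eq_zero_iff_mem.mp ((map_one _).trans h))
    simp [RingHom.mem_ker] at this
  · have : quotientComponent (Ideal.span (Set.range (X : Fin n → MvPolynomial (Fin n) F))) d = ⊥ := by
      rw [eq_bot_iff]
      rintro _ ⟨p, hp, rfl⟩
      refine Ideal.Quotient.eq_zero_iff_mem.mpr (mem_span_range_X_of_constantCoeff_eq_zero ?_)
      exact IsHomogeneous.coeff_eq_zero hp (by simpa using Ne.symm hd)
    rw [this, finrank_bot, Nat.cast_zero]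

/-- Applying the product formula to the variables themselves avoids counting monomials. -/
theorem one_sub_X_pow_mul_quotientHilbertSeries_bot :
    (1 - PowerSeries.X) ^ n * quotientHilbertSeries (⊥ : Ideal (MvPolynomial (Fin n) F)) = 1 := by
  have h := quotientHilbertSeries_ofList (isWeaklyRegular_ofFn_X F n) (fun _ => 1)
    (fun i hi => by rw [List.getElem_ofFn]; exact isHomogeneous_X F _)
  rw [show Ideal.ofList (List.ofFn (X : Fin n → MvPolynomial (Fin n) F)) =
    Ideal.span (Set.range X) from congrArg Ideal.span (by ext; simp),
    quotientHilbertSeries_span_X] at h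
  simpa using h.symm

theorem module_finite_and_finrank_quotient {I : Ideal (MvPolynomial (Fin n) F)}
    (hI : ∀ p ∈ I, ∀ d, homogeneousComponent d p ∈ I) {N : ℕ}
    (hN : ∀ d, N ≤ d → quotientComponent I d = ⊥) :
    Module.Finite F (MvPolynomial (Fin n) F ⧸ I) ∧
      Module.finrank F (MvPolynomial (Fin n) F ⧸ I) =
        ∑ d ∈ Finset.range N, Module.finrank F (quotientComponent I d) := by
  let Ψ : ((d : Fin N) → quotientComponent I d) →ₗ[F] (MvPolynomial (Fin n) F ⧸ I) :=
    ∑ d : Fin N, (quotientComponent I d).subtype ∘ₗ LinearMap.proj d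
  have hΨ (q) : Ψ q = ∑ d, (q d : MvPolynomial (Fin n) F ⧸ I) := by
    simp [Ψ, LinearMap.sum_apply]
  have hinj : Function.Injective Ψ := by
    rw [← LinearMap.ker_eq_bot, LinearMap.ker_eq_bot']
    intro q hq
    choose p hp hpq using fun d => mem_quotientComponent.mp (q d).2
    rw [hΨ] at hq
    simp_rw [← hpq] at hq
    rw [← map_sum, Ideal.Quotient.eq_zero_iff_mem] at hq
    ext c
    rw [← hpq c]
    refine Ideal.Quotient.eq_zero_iff_mem.mpr ?_
    have := hI _ hq c
    rw [map_sum] at this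
    convert this
    rw [Finset.sum_eq_single c, homogeneousComponent_eq_self (hp c)]
    · intro b _ hb
      rw [homogeneousComponent_of_mem (hp b), if_neg (by simpa [Fin.ext_iff] using hb.symm)]
    · simp
  have hsurj : Function.Surjective Ψ := by
    intro v
    obtain ⟨p, rfl⟩ := Ideal.Quotient.mk_surjective v
    rw [← LinearMap.mem_range, ← sum_homogeneousComponent p, map_sum]
    refine Submodule.sum_mem _ fun d _ => ?_
    have hd : Ideal.Quotient.mk I (homogeneousComponent d p) ∈ quotientComponent I d :=
      ⟨_, homogeneousComponent_isHomogeneous d p, rfl⟩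
    by_cases hdN : d < N
    · refine ⟨Pi.single ⟨d, hdN⟩ ⟨_, hd⟩, ?_⟩
      rw [hΨ, Finset.sum_eq_single ⟨d, hdN⟩]
      · simp
      · intro b _ hb
        simp [Pi.single_eq_of_ne hb]
      · simp
    · rw [hN d (by omega), Submodule.mem_bot] at hd
      rw [hd]
      exact Submodule.zero_mem _
  let E := LinearEquiv.ofBijective Ψ ⟨hinj, hsurj⟩
  refine ⟨Module.Finite.equiv E, ?_⟩
  rw [← E.finrank_eq, Module.finrank_pi_fintype,
    Finset.sum_range fun d => Module.finrank F (quotientComponent I d)]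

end WeightedPowerSum

/-! ### Common zeros of weighted power sums, and the theorem. -/

namespace WeightedPowerSum

open MvPolynomial

section Field

variable {F : Type*} [Field F] {n : ℕ}

theorem eval_phi (a x : Fin n → F) (m : ℕ) : eval x (phi a m) = ∑ i, a i * x i ^ m := by
  simp [phi]

theorem ofList_ofFn_phi (a : Fin n → F) (k : ℕ) :
    Ideal.ofList (List.ofFn fun j : Fin n => phi a (k + j)) = PhiIdeal a k :=
  congrArg Ideal.span (by ext; simp)

theorem sum_ne_zero_of_X_mem_radical {a : Fin n → F} (h : ∀ i, X i ∈ (PhiIdeal a 1).radical)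
    {s : Finset (Fin n)} (hs : s.Nonempty) : ∑ i ∈ s, a i ≠ 0 := by
  intro h0
  obtain ⟨i, hi⟩ := hs
  let x : Fin n → F := fun j => if j ∈ s then 1 else 0
  have hle : PhiIdeal a 1 ≤ RingHom.ker (eval x) := by
    rw [PhiIdeal, Ideal.span_le]
    rintro _ ⟨j, rfl⟩
    simp [RingHom.mem_ker, eval_phi, x, ite_pow, h0]
  have := (RingHom.ker_isPrime (eval x)).radical_le_iff.mpr hle (h i)
  simp [RingHom.mem_ker, x, hi] at this

/-- If no nonempty subsum of the weights vanishes, then `n` consecutive weighted power sums have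
only the trivial common zero. -/
theorem eq_zero_of_forall_sum_mul_pow_eq_zero {a : Fin n → F}
    (ha : ∀ s : Finset (Fin n), s.Nonempty → ∑ i ∈ s, a i ≠ 0) {k : ℕ} {x : Fin n → F}
    (hx : ∀ j : Fin n, ∑ i, a i * x i ^ (k + j) = 0) : x = 0 := by
  classical
  have hp (p : Polynomial F) (hdeg : p.natDegree < n) :
      ∑ i, a i * x i ^ k * p.eval (x i) = 0 := by
    simp_rw [Polynomial.eval_eq_sum_range' hdeg, Finset.mul_sum]
    rw [Finset.sum_comm]
    refine Finset.sum_eq_zero fun j hj => ?_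
    rw [← mul_zero (p.coeff j), ← hx ⟨j, Finset.mem_range.mp hj⟩, Finset.mul_sum]
    refine Finset.sum_congr rfl fun i _ => ?_
    rw [pow_add]
    ring
  by_contra hne
  obtain ⟨i₀, hi₀⟩ : ∃ i, x i ≠ 0 := Function.ne_iff.mp hne
  -- The polynomial `p` kills every value of `x` except `x i₀`. There are at most `n` distinct
  -- values, so its degree is below `n`, and the relations leave only the weights on the fibre of `x
  -- i₀`.
  let V := (Finset.univ.image x).erase (x i₀)
  let p : Polynomial F := ∏ w ∈ V, (Polynomial.X - Polynomial.C w)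
  have hdeg : p.natDegree < n := by
    rw [Polynomial.natDegree_prod_of_monic _ _ fun w _ => Polynomial.monic_X_sub_C w]
    simp only [Polynomial.natDegree_X_sub_C, Finset.sum_const, smul_eq_mul, mul_one]
    calc V.card < (Finset.univ.image x).card :=
          Finset.card_erase_lt_of_mem (Finset.mem_image_of_mem _ (Finset.mem_univ _))
      _ ≤ n := Finset.card_image_le.trans (by simp)
  have hp0 : p.eval (x i₀) ≠ 0 := by
    rw [Polynomial.eval_prod, Finset.prod_ne_zero_iff]
    intro w hw
    simpa [sub_eq_zero] using (Finset.ne_of_mem_erase hw).symm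
  have hp1 (i) (hi : x i ≠ x i₀) : p.eval (x i) = 0 := by
    rw [Polynomial.eval_prod]
    exact Finset.prod_eq_zero (Finset.mem_erase.mpr
      ⟨hi, Finset.mem_image_of_mem _ (Finset.mem_univ _)⟩) (by simp)
  have hsum : (∑ i with x i = x i₀, a i) * (x i₀ ^ k * p.eval (x i₀)) = 0 := by
    rw [← hp p hdeg, Finset.sum_mul, Finset.sum_filter]
    refine Finset.sum_congr rfl fun i _ => ?_
    split_ifs with hi
    · rw [hi, mul_assoc]
    · rw [hp1 i hi, mul_zero]
  exact ha _ ⟨i₀, by simp⟩ ((mul_eq_zero.mp hsum).resolve_right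
    (mul_ne_zero (pow_ne_zero k hi₀) hp0))

/-- Nullstellensatz; algebraic closedness enters the argument only here. -/
theorem X_mem_radical_PhiIdeal [IsAlgClosed F] {a : Fin n → F}
    (ha : ∀ s : Finset (Fin n), s.Nonempty → ∑ i ∈ s, a i ≠ 0) (k : ℕ) (i : Fin n) :
    X i ∈ (PhiIdeal a k).radical := by
  rw [← vanishingIdeal_zeroLocus_eq_radical (K := F), mem_vanishingIdeal_iff]
  intro x hx
  rw [eq_zero_of_forall_sum_mul_pow_eq_zero ha (k := k) (x := x) fun j => ?_]
  · simp
  · rw [← eval_phi, ← MvPolynomial.coe_aeval_eq_eval]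
    exact mem_zeroLocus_iff.mp hx _ (Ideal.subset_span ⟨j, rfl⟩)

theorem isWeaklyRegular_phi_of_X_mem_radical {a : Fin n → F} {k : ℕ} (hk : 1 ≤ k)
    (h : ∀ i, X i ∈ (PhiIdeal a k).radical) :
    IsWeaklyRegular (MvPolynomial (Fin n) F) (List.ofFn fun j : Fin n => phi a (k + j)) := by
  refine isWeaklyRegular_of_X_mem_radical _ (by simp) (fun f hf => ?_)
    (by rwa [ofList_ofFn_phi])
  obtain ⟨j, rfl⟩ := (List.mem_ofFn' _ _).mp hf
  exact ⟨k + j, by omega, phi_isHomogeneous a _⟩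

theorem isRegular_phi {a : Fin n → F} {k : ℕ} (hk : 1 ≤ k)
    (h : IsWeaklyRegular (MvPolynomial (Fin n) F) (List.ofFn fun j : Fin n => phi a (k + j))) :
    IsRegular (MvPolynomial (Fin n) F) (List.ofFn fun j : Fin n => phi a (k + j)) := by
  refine ⟨h, ?_⟩
  rw [ofList_ofFn_phi, smul_eq_mul, Ideal.mul_top]
  intro htop
  have hle : PhiIdeal a k ≤ RingHom.ker (eval (0 : Fin n → F)) := by
    rw [PhiIdeal, Ideal.span_le]
    rintro _ ⟨j, rfl⟩
    have : k + (j : ℕ) ≠ 0 := by omega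
    rw [SetLike.mem_coe, RingHom.mem_ker, eval_phi]
    simp [zero_pow this]
  exact RingHom.ker_ne_top (eval (0 : Fin n → F)) (top_le_iff.mp (htop.le.trans hle))

theorem quotientHilbertSeries_PhiIdeal {a : Fin n → F} {k : ℕ}
    (h : IsWeaklyRegular (MvPolynomial (Fin n) F) (List.ofFn fun j : Fin n => phi a (k + j))) :
    quotientHilbertSeries (PhiIdeal a k) = ∏ j ∈ Finset.range n, tInt (k + j) := by
  have hH := quotientHilbertSeries_ofList h (fun j => k + j)
    (fun i hi => by rw [List.getElem_ofFn]; exact phi_isHomogeneous a _)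
  have hgeom (m : ℕ) : (1 - PowerSeries.X ^ m : PowerSeries ℤ) =
      tInt m * (1 - PowerSeries.X) := (geom_sum_mul_neg _ _).symm
  simp_rw [hgeom] at hH
  rw [ofList_ofFn_phi, List.length_ofFn, Finset.prod_mul_distrib, Finset.prod_const,
    Finset.card_range, mul_assoc, one_sub_X_pow_mul_quotientHilbertSeries_bot, mul_one] at hH
  exact hH

/-- The polynomial `[k]_t [k+1]_t ⋯ [k+n-1]_t`. -/
noncomputable def tPolynomial (k n : ℕ) : Polynomial ℤ :=
  ∏ j ∈ Finset.range n, ∑ i ∈ Finset.range (k + j), Polynomial.X ^ i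

theorem coe_tPolynomial (k n : ℕ) :
    (tPolynomial k n : PowerSeries ℤ) = ∏ j ∈ Finset.range n, tInt (k + j) := by
  rw [tPolynomial, ← Polynomial.coeToPowerSeries.ringHom_apply, map_prod]
  simp [tInt]

theorem eval_one_tPolynomial (k n : ℕ) :
    (tPolynomial k n).eval 1 = ∏ j ∈ Finset.range n, ((k + j : ℕ) : ℤ) := by
  simp [tPolynomial, Polynomial.eval_prod, Polynomial.eval_finsetSum]

/-- The factor `[1 + j]_t` has degree `j`, and `0 + 1 + ⋯ + (n - 1) = n.choose 2`; this is the
source of the exponent `n.choose 2 + 1`. -/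
theorem natDegree_tPolynomial_one_le (n : ℕ) : (tPolynomial 1 n).natDegree ≤ n.choose 2 := by
  refine (Polynomial.natDegree_prod_le _ _).trans ?_
  rw [Nat.choose_two_right, ← Finset.sum_range_id]
  refine Finset.sum_le_sum fun j _ => Polynomial.natDegree_sum_le_of_forall_le _ _ fun i hi => ?_
  rw [Polynomial.natDegree_X_pow]
  have := Finset.mem_range.mp hi
  omega

theorem finrank_quotientComponent_PhiIdeal {a : Fin n → F} {k : ℕ}
    (h : IsWeaklyRegular (MvPolynomial (Fin n) F) (List.ofFn fun j : Fin n => phi a (k + j)))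
    (d : ℕ) : (Module.finrank F (quotientComponent (PhiIdeal a k) d) : ℤ) =
      (tPolynomial k n).coeff d := by
  rw [← coeff_quotientHilbertSeries, quotientHilbertSeries_PhiIdeal h, ← coe_tPolynomial,
    Polynomial.coeff_coe]

theorem quotientComponent_PhiIdeal_eq_bot {a : Fin n → F} {k : ℕ}
    (h : IsWeaklyRegular (MvPolynomial (Fin n) F) (List.ofFn fun j : Fin n => phi a (k + j)))
    {d : ℕ} (hd : (tPolynomial k n).natDegree < d) :
    quotientComponent (PhiIdeal a k) d = ⊥ := by
  have := finrank_quotientComponent_PhiIdeal h d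
  rw [Polynomial.coeff_eq_zero_of_natDegree_lt hd] at this
  exact Submodule.finrank_eq_zero.mp (by exact_mod_cast this)

theorem X_pow_mem_PhiIdeal {a : Fin n → F}
    (h : IsWeaklyRegular (MvPolynomial (Fin n) F) (List.ofFn fun j : Fin n => phi a (1 + j)))
    (i : Fin n) : X i ^ (n.choose 2 + 1) ∈ PhiIdeal a 1 := by
  have hbot := quotientComponent_PhiIdeal_eq_bot h
    (Nat.lt_succ_of_le (natDegree_tPolynomial_one_le n))
  have hmem : Ideal.Quotient.mk (PhiIdeal a 1) (X i ^ (n.choose 2 + 1)) ∈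
      quotientComponent (PhiIdeal a 1) (n.choose 2 + 1) := ⟨_, isHomogeneous_X_pow i _, rfl⟩
  rw [hbot, Submodule.mem_bot] at hmem
  exact Ideal.Quotient.eq_zero_iff_mem.mp hmem

theorem module_finite_and_finrank_PhiIdeal {a : Fin n → F} {k : ℕ}
    (h : IsWeaklyRegular (MvPolynomial (Fin n) F) (List.ofFn fun j : Fin n => phi a (k + j))) :
    Module.Finite F (MvPolynomial (Fin n) F ⧸ PhiIdeal a k) ∧
      Module.finrank F (MvPolynomial (Fin n) F ⧸ PhiIdeal a k) =
        ∏ j ∈ Finset.range n, (k + j) := by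
  obtain ⟨hfin, hrank⟩ := module_finite_and_finrank_quotient (I := PhiIdeal a k)
    (N := (tPolynomial k n).natDegree + 1)
    (fun p hp d => homogeneousComponent_mem_span
      (by rintro _ ⟨j, rfl⟩; exact ⟨_, phi_isHomogeneous a _⟩) hp d)
    (fun d hd => quotientComponent_PhiIdeal_eq_bot h hd)
  refine ⟨hfin, ?_⟩
  -- The total dimension is the Hilbert polynomial in `t` evaluated at `t = 1`.
  have : (Module.finrank F (MvPolynomial (Fin n) F ⧸ PhiIdeal a k) : ℤ) =
      ∏ j ∈ Finset.range n, ((k + j : ℕ) : ℤ) := by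
    rw [hrank, ← eval_one_tPolynomial, Polynomial.eval_eq_sum_range]
    push_cast
    simp_rw [finrank_quotientComponent_PhiIdeal h, one_pow, mul_one]
  exact_mod_cast this

end Field

end WeightedPowerSum

theorem mainTheorem7 {F : Type*} [Field F] [IsAlgClosed F] (n : ℕ) (a : Fin n → F) :
    (RingTheory.Sequence.IsRegular (MvPolynomial (Fin n) F)
        (List.ofFn fun j : Fin n => WeightedPowerSum.phi a (j + 1)) ↔
      ∀ i : Fin n, (MvPolynomial.X i : MvPolynomial (Fin n) F) ^ (n.choose 2 + 1) ∈
        WeightedPowerSum.PhiIdeal a 1) ∧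
    (RingTheory.Sequence.IsRegular (MvPolynomial (Fin n) F)
        (List.ofFn fun j : Fin n => WeightedPowerSum.phi a (j + 1)) →
      ∀ k : ℕ, 1 ≤ k →
        WeightedPowerSum.quotientHilbertSeries (WeightedPowerSum.PhiIdeal a k) =
            ∏ j ∈ Finset.range n, WeightedPowerSum.tInt (k + j) ∧
        Module.Finite F (MvPolynomial (Fin n) F ⧸ WeightedPowerSum.PhiIdeal a k) ∧
        Module.finrank F (MvPolynomial (Fin n) F ⧸ WeightedPowerSum.PhiIdeal a k) =
            ∏ j ∈ Finset.range n, (k + j)) := by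
  simp_rw [fun j : Fin n => add_comm (j : ℕ) 1]
  refine ⟨⟨fun h i => WeightedPowerSum.X_pow_mem_PhiIdeal h.toIsWeaklyRegular i, fun h => ?_⟩,
    fun h k hk => ?_⟩
  · exact WeightedPowerSum.isRegular_phi le_rfl
      (WeightedPowerSum.isWeaklyRegular_phi_of_X_mem_radical le_rfl fun i => ⟨_, h i⟩)
  · have hrad (i) : MvPolynomial.X i ∈ (WeightedPowerSum.PhiIdeal a 1).radical :=
      ⟨_, WeightedPowerSum.X_pow_mem_PhiIdeal h.toIsWeaklyRegular i⟩
    have hreg := WeightedPowerSum.isWeaklyRegular_phi_of_X_mem_radical hk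
      (WeightedPowerSum.X_mem_radical_PhiIdeal
        (fun _ hs => WeightedPowerSum.sum_ne_zero_of_X_mem_radical hrad hs) k)
    exact ⟨WeightedPowerSum.quotientHilbertSeries_PhiIdeal hreg,
      WeightedPowerSum.module_finite_and_finrank_PhiIdeal hreg⟩
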